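/- Let $n>3$ and let $A=LL^*\in M_n(\mathbb{C})$ be a positive semi-definite matrix, where $L=(L_{ij})$ is a lower triangular complex matrix. Put $$M_n=\begin{cases} n^n-(n-1)^n-n!-n^{\frac{n-4}{2}}\left(\frac{n-2}{2}\right)^{\frac{n+2}{2}}\left(\frac{n+4}{2}\right)-1, & n \text{ even},\\[2pt] n^n-(n-1)^n-n!-n^{\frac{n-5}{2}}\left(\frac{n-1}{2}\right)^{\frac{n+1}{2}}\left(\frac{n+3}{2}\right)-1, & n\text{ odd},\end{cases}$$ $$\alpha=\prod_{i=1}^n|L_{i1}|,\qquad \alpha_0=\max_{1\le i\le n}|L_{i1}|,\qquad \epsilon_n=\min\left\{\frac{\alpha}{\alpha_0^{\,n-1}}\sqrt{\frac{2}{3\,n!\,M_n}},\,1\right\},$$ $m=\max\{|L_{ij}| : 2\le i,j\le n\}$, and assume $m>0$. Let $a=\epsilon_n/m$. If every entry in the first column of $A$ is non-zero, then $$[A]:=\{L\,\operatorname{diag}(1,\lambda_2^2,\dots,\lambda_n^2)\,L^* : 0<\lambda_2,\dots,\lambda_n\le a\}$$ is an infinite set of positive semi-definite matrices, each of which satisfies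 the permanent dominant conjecture. Here a matrix $X\in M_n(\mathbb{C})$ is said to satisfy the permanent dominant conjecture if, for every subgroup $G\le S_n$ and every irreducible complex character $\chi$ of $G$, $$\frac{1}{\chi(e)}\sum_{g\in G}\chi(g)\prod_{i=1}^n X_{i\,g(i)}\le \operatorname{per}(X),$$ both sides being real. -/

import Mathlib

open scoped ComplexOrder Matrix Nat

namespace PermDom

noncomputable section

/-- `χ` is the character of an irreducible finite-dimensional complex representation of `G`.
Every such representation is isomorphic to one on some `ℂ^d`. -/
def IsIrreducibleCharacter {G : Type*} [Group G] (χ : G → ℂ) : Prop :=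
  ∃ (d : ℕ) (ρ : Representation ℂ G (Fin d → ℂ)), ρ.IsIrreducible ∧ χ = ρ.character

open Classical in
/-- The generalized matrix function `d^G_χ(A) = ∑_{g ∈ G} χ(g) ∏_i A_{i, g(i)}`. -/
def genMatrixFun {n : ℕ} (G : Subgroup (Equiv.Perm (Fin n))) (χ : G → ℂ)
    (A : Matrix (Fin n) (Fin n) ℂ) : ℂ :=
  ∑ g : G, χ g * ∏ i, A i ((g : Equiv.Perm (Fin n)) i)

/-- The normalized generalized matrix function `(1 / χ(e)) d^G_χ(A)`. -/
def normGenMatrixFun {n : ℕ} (G : Subgroup (Equiv.Perm (Fin n))) (χ : G → ℂ)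
    (A : Matrix (Fin n) (Fin n) ℂ) : ℂ :=
  (1 / χ 1) * genMatrixFun G χ A

/-- `A` satisfies the permanent dominant conjecture: for every subgroup `G` of the symmetric group
and every irreducible character `χ` of `G`, the normalized generalized matrix function of `A` is at
most the permanent of `A`. The order on `ℂ` is `z ≤ w ↔ z.re ≤ w.re ∧ z.im = w.im`. -/
def SatisfiesPermanentDominance {n : ℕ} (A : Matrix (Fin n) (Fin n) ℂ) : Prop :=
  ∀ (G : Subgroup (Equiv.Perm (Fin n))) (χ : G → ℂ), IsIrreducibleCharacter χ →
    normGenMatrixFun G χ A ≤ A.permanent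

/-- The number `M_n`, for `n > 3`. All exponents are exact quotients (no rounding) for `n ≥ 4`. -/
def bigM (n : ℕ) : ℝ :=
  if Even n then
    (n : ℝ) ^ n - ((n : ℝ) - 1) ^ n - (n ! : ℝ)
      - (n : ℝ) ^ ((n - 4) / 2) * (((n : ℝ) - 2) / 2) ^ ((n + 2) / 2) * (((n : ℝ) + 4) / 2) - 1
  else
    (n : ℝ) ^ n - ((n : ℝ) - 1) ^ n - (n ! : ℝ)
      - (n : ℝ) ^ ((n - 5) / 2) * (((n : ℝ) - 1) / 2) ^ ((n + 1) / 2) * (((n : ℝ) + 3) / 2) - 1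

/-- `α = ∏_i |L_{i1}|`, the first column having index `0 : Fin n`. -/
def firstColProd {n : ℕ} [NeZero n] (L : Matrix (Fin n) (Fin n) ℂ) : ℝ :=
  ∏ i, ‖L i 0‖

/-- `α₀ = max_i |L_{i1}|`. -/
def firstColMax {n : ℕ} [NeZero n] (L : Matrix (Fin n) (Fin n) ℂ) : ℝ :=
  ⨆ i, ‖L i 0‖

/-- `ε_n = min {(α / α₀^{n-1}) √(2 / (3 n! M_n)), 1}`. -/
def eps {n : ℕ} [NeZero n] (L : Matrix (Fin n) (Fin n) ℂ) : ℝ :=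
  min (firstColProd L / firstColMax L ^ (n - 1) * √(2 / (3 * (n ! : ℝ) * bigM n))) 1

/-- `m = max {|L_{ij}| : 2 ≤ i, j ≤ n}`. -/
def restMax {n : ℕ} [NeZero n] (L : Matrix (Fin n) (Fin n) ℂ) : ℝ :=
  ⨆ p : {i : Fin n // i ≠ 0} × {j : Fin n // j ≠ 0}, ‖L p.1 p.2‖

/-- The class of all `L diag(1, λ_2², …, λ_n²) L*` with `0 < λ_2, …, λ_n ≤ a`
(the value `l 0` is not used). -/
def matrixClass {n : ℕ} [NeZero n] (L : Matrix (Fin n) (Fin n) ℂ) (a : ℝ) :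
    Set (Matrix (Fin n) (Fin n) ℂ) :=
  {X | ∃ l : Fin n → ℝ, (∀ i, i ≠ 0 → 0 < l i ∧ l i ≤ a) ∧
    X = L * Matrix.diagonal (fun i => if i = 0 then (1 : ℂ) else (l i : ℂ) ^ 2) * Lᴴ}

end

end PermDom

/-! Let `v` be the first column of `L`. A matrix in the class is `v vᴴ + E`, where the scaling makes
every entry of `E` at most `(n - 1) ε²`. For `v vᴴ` every permutation gives the same diagonal
product `c = α²`, so the diagonal products of the class member all lie within some `η` of `c`; `ε`
is small enough that `4η ≤ c` (`eps_sq_mul_le`, `norm_prod_add_sub_prod_le`).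

This closeness suffices (`satisfiesPermanentDominance_of_near`), since `per ≥ n! (c - η)`. A
nontrivial irreducible character sums to zero, so `c` cancels and at most `|G| η` remains. For the
trivial character, a proper subgroup has at most `n!/2` elements and gives at most `(n!/2)(c + η)`;
the full group gives the permanent itself. -/

namespace PermDom

/-! ### Irreducible characters of finite groups -/

section Characters

variable {G : Type*} [Group G] [Finite G] {d : ℕ} (ρ : Representation ℂ G (Fin d → ℂ))

/-- Character values are sums of `d` roots of unity, hence bounded by `d`. -/
theorem norm_character_le (g : G) : ‖ρ.character g‖ ≤ d := by
  have hroots : ∀ μ ∈ (ρ g).charpoly.roots, ‖μ‖ = 1 := by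
    intro μ hμ
    have hs : μ ∈ spectrum ℂ (ρ g) :=
      (Module.End.mem_spectrum_iff_isRoot_charpoly _ _).2 (Polynomial.isRoot_of_mem_roots hμ)
    obtain ⟨N, hN, hgN⟩ := isOfFinOrder_iff_pow_eq_one.1 (isOfFinOrder_of_finite g)
    have hp := spectrum.pow_mem_pow (ρ g) N hs
    rw [← map_pow, hgN, map_one] at hp
    have hnt : Nontrivial (Module.End ℂ (Fin d → ℂ)) := by
      by_contra hnt
      rw [not_nontrivial_iff_subsingleton] at hnt
      simp [spectrum.of_subsingleton] at hp
    rw [spectrum.one_eq] at hp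
    exact Complex.norm_eq_one_of_pow_eq_one hp hN.ne'
  rw [Representation.character,
    Module.End.trace_eq_sum_roots_charpoly_of_splits (IsAlgClosed.splits _)]
  refine (norm_multiset_sum_le _).trans ?_
  rw [Multiset.map_congr rfl hroots]
  simp only [Multiset.map_const', Multiset.sum_replicate, nsmul_eq_mul, mul_one, Nat.cast_le]
  refine (Polynomial.card_roots' _).trans ?_
  simp [LinearMap.charpoly_natDegree]

/-- Averaging the standard inner product makes the representation unitary. -/
theorem character_inv (g : G) : ρ.character g⁻¹ = star (ρ.character g) := by
  classical
  have := Fintype.ofFinite G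
  let M : G → Matrix (Fin d) (Fin d) ℂ := fun g => LinearMap.toMatrix' (ρ g)
  have hmul : ∀ g h, M (g * h) = M g * M h := fun g h => by
    simp [M, Module.End.mul_eq_comp, LinearMap.toMatrix'_comp]
  have hone : M 1 = 1 := by simp [M, Module.End.one_eq_id]
  have htr : ∀ g, ρ.character g = (M g).trace := fun g =>
    (LinearMap.trace_eq_matrix_trace ℂ (Pi.basisFun ℂ (Fin d)) (ρ g)).trans (by
      simp [M, LinearMap.toMatrix_eq_toMatrix'])
  -- The summand at the identity is the identity matrix, which makes `H` definite; its invariance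
  -- makes `M g⁻¹` similar to `(M g)ᴴ`.
  let H : Matrix (Fin d) (Fin d) ℂ := ∑ h, (M h)ᴴ * M h
  have hH : H.PosDef := by
    have h0 : (∑ h ∈ Finset.univ.erase (1 : G), (M h)ᴴ * M h).PosSemidef :=
      Matrix.posSemidef_sum _ fun h _ => Matrix.posSemidef_conjTranspose_mul_self _
    have h1 : H = 1 + ∑ h ∈ Finset.univ.erase (1 : G), (M h)ᴴ * M h := by
      rw [show H = ∑ h, (M h)ᴴ * M h from rfl,
        ← Finset.add_sum_erase _ _ (Finset.mem_univ (1 : G)), hone]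
      simp
    rw [h1]
    exact Matrix.PosDef.one.add_posSemidef h0
  have hinv : (M g)ᴴ * H * M g = H := by
    simp only [H, Finset.mul_sum, Finset.sum_mul]
    rw [← Equiv.sum_comp (Equiv.mulRight g) (fun h => (M h)ᴴ * M h)]
    refine Finset.sum_congr rfl fun h _ => ?_
    simp [hmul, Matrix.mul_assoc]
  have hgg : M g * M g⁻¹ = 1 := by rw [← hmul, mul_inv_cancel, hone]
  have hcomm : H * M g⁻¹ = (M g)ᴴ * H := by
    calc H * M g⁻¹ = (M g)ᴴ * H * (M g * M g⁻¹) := by rw [← Matrix.mul_assoc, hinv]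
      _ = _ := by rw [hgg, Matrix.mul_one]
  have hu : IsUnit H.det := (Matrix.isUnit_iff_isUnit_det _).1 hH.isUnit
  have hM : M g⁻¹ = H⁻¹ * ((M g)ᴴ * H) := by
    rw [← hcomm, ← Matrix.mul_assoc, Matrix.nonsing_inv_mul _ hu, Matrix.one_mul]
  rw [htr, htr, hM, Matrix.trace_mul_comm, Matrix.mul_assoc, Matrix.mul_nonsing_inv _ hu,
    Matrix.mul_one, Matrix.trace_conjTranspose]

omit [Finite G] in
/-- An irreducible representation is trivial, or its character sums to zero. -/
theorem character_eq_const_or_sum_eq_zero [Fintype G] (hρ : ρ.IsIrreducible) :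
    (∀ g, ρ.character g = d) ∨ ∑ g, ρ.character g = 0 := by
  have : Invertible (Nat.card G : ℂ) := invertibleOfNonzero (by simp)
  have havg := ρ.card_inv_mul_sum_char_eq_finrank
  let S : Subrepresentation ρ := ⟨ρ.invariants, fun g v hv => by rwa [hv g]⟩
  rcases hρ.eq_bot_or_eq_top S with h | h
  · right
    have h0 : ρ.invariants = ⊥ := congrArg Subrepresentation.toSubmodule h
    rw [h0, finrank_bot] at havg
    simpa using havg
  · left
    intro g
    have h0 : ρ.invariants = ⊤ := congrArg Subrepresentation.toSubmodule h
    have h1 : ρ g = 1 := by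
      refine LinearMap.ext fun v => ?_
      have hv : v ∈ ρ.invariants := h0 ▸ Submodule.mem_top
      exact hv g
    rw [Representation.character, h1]
    simp

omit [Finite G] in
theorem degree_pos (hρ : ρ.IsIrreducible) : 0 < d := by
  rcases Nat.eq_zero_or_pos d with rfl | h
  · obtain ⟨a, b, hab⟩ := hρ.toNontrivial
    refine absurd ?_ hab
    exact Subrepresentation.toSubmodule_injective (Subsingleton.elim _ _)
  · exact h

end Characters

/-! ### Dominance for nearly constant diagonal products -/

section Dominance

variable {n : ℕ} {X : Matrix (Fin n) (Fin n) ℂ}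

theorem permanent_eq_sum (X : Matrix (Fin n) (Fin n) ℂ) :
    X.permanent = ∑ σ : Equiv.Perm (Fin n), ∏ i, X i (σ i) := by
  rw [← Matrix.permanent_transpose]
  rfl

theorem star_diagonal_product (hX : X.IsHermitian) (σ : Equiv.Perm (Fin n)) :
    star (∏ i, X i (σ i)) = ∏ i, X i (σ⁻¹ i) := by
  rw [star_prod, ← Equiv.prod_comp σ fun i => X i (σ⁻¹ i)]
  simp [hX.apply]

theorem permanent_im (hX : X.IsHermitian) : X.permanent.im = 0 := by
  rw [← Complex.conj_eq_iff_im, permanent_eq_sum]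
  change star _ = _
  rw [star_sum, ← Equiv.sum_comp (Equiv.inv _)]
  simp only [star_diagonal_product hX, Equiv.inv_apply, inv_inv]

theorem genMatrixFun_im (hX : X.IsHermitian) (G : Subgroup (Equiv.Perm (Fin n))) {χ : G → ℂ}
    (hχ : ∀ g, χ g⁻¹ = star (χ g)) : (genMatrixFun G χ X).im = 0 := by
  classical
  rw [← Complex.conj_eq_iff_im, genMatrixFun]
  change star _ = _
  rw [star_sum, ← Equiv.sum_comp (Equiv.inv _)]
  refine Finset.sum_congr rfl fun g _ => ?_
  simp only [Equiv.inv_apply, star_mul', hχ, star_star, InvMemClass.coe_inv,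
    star_diagonal_product hX, inv_inv]

/-- A Hermitian matrix all of whose diagonal products are close to one positive number satisfies
the permanent dominance conjecture. -/
theorem satisfiesPermanentDominance_of_near (hX : X.IsHermitian) {c η : ℝ}
    (hη : 4 * η ≤ c) (hp : ∀ σ : Equiv.Perm (Fin n), ‖∏ i, X i (σ i) - (c : ℂ)‖ ≤ η) :
    SatisfiesPermanentDominance X := by
  classical
  rintro G χ ⟨d, ρ, hρ, rfl⟩
  have hd : 0 < d := degree_pos ρ hρ
  have hη0 : 0 ≤ η := (norm_nonneg _).trans (hp 1)
  have hone : ρ.character 1 = (d : ℂ) := by simp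
  have hdC : (d : ℂ) ≠ 0 := by exact_mod_cast hd.ne'
  have him : (normGenMatrixFun G ρ.character X).im = 0 := by
    rw [normGenMatrixFun, hone]
    have := genMatrixFun_im hX G (character_inv ρ)
    rw [one_div, ← Complex.ofReal_natCast, ← Complex.ofReal_inv, Complex.im_ofReal_mul, this,
      mul_zero]
  have hper : (n ! : ℝ) * (c - η) ≤ X.permanent.re := by
    rw [permanent_eq_sum, Complex.re_sum]
    have : ∀ σ ∈ (Finset.univ : Finset (Equiv.Perm (Fin n))), c - η ≤ (∏ i, X i (σ i)).re := by
      intro σ _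
      have := (abs_le.1 ((Complex.abs_re_le_norm _).trans (hp σ))).1
      simp only [Complex.sub_re, Complex.ofReal_re] at this
      linarith
    simpa [Fintype.card_perm] using Finset.card_nsmul_le_sum _ _ _ this
  have hcardG : Fintype.card G ≤ n ! := by
    simpa [Fintype.card_perm] using Fintype.card_subtype_le (· ∈ G)
  have hcardR : (Fintype.card G : ℝ) ≤ n ! := by exact_mod_cast hcardG
  have hfac : (0 : ℝ) < n ! := by exact_mod_cast n.factorial_pos
  suffices h : normGenMatrixFun G ρ.character X = X.permanent ∨
      (normGenMatrixFun G ρ.character X).re ≤ X.permanent.re by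
    rcases h with h | h
    · exact h.le
    · exact Complex.le_def.2 ⟨h, him.trans (permanent_im hX).symm⟩
  have hgen : ∀ χ : G → ℂ, genMatrixFun G χ X = ∑ g : G, χ g * ∏ i, X i ((g : Equiv.Perm _) i) := by
    intro χ
    unfold genMatrixFun
    congr!
  rcases character_eq_const_or_sum_eq_zero ρ hρ with hc | hc
  · have hsum : normGenMatrixFun G ρ.character X = ∑ g : G, ∏ i, X i ((g : Equiv.Perm _) i) := by
      simp only [normGenMatrixFun, hgen, hc, ← Finset.mul_sum]
      field_simp
    by_cases hG : G = ⊤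
    · left
      subst hG
      rw [hsum, permanent_eq_sum]
      exact Equiv.sum_comp Subgroup.topEquiv.toEquiv fun σ : Equiv.Perm (Fin n) => ∏ i, X i (σ i)
    · right
      -- Index at least 2 gains the factor that absorbs the error: `c + η ≤ 2 (c - η)`.
      have hidx : 2 * Fintype.card G ≤ n ! := by
        have h1 := G.card_mul_index
        rw [Nat.card_eq_fintype_card, Nat.card_eq_fintype_card, Fintype.card_perm,
          Fintype.card_fin] at h1
        have h2 : G.index ≠ 1 := fun h => hG (Subgroup.index_eq_one.1 h)
        have h3 : G.index ≠ 0 := Subgroup.index_ne_zero_of_finite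
        have h4 : 2 ≤ G.index := by omega
        nlinarith
      have hidxR : 2 * (Fintype.card G : ℝ) ≤ n ! := by exact_mod_cast hidx
      have hle : (normGenMatrixFun G ρ.character X).re ≤ Fintype.card G * (c + η) := by
        rw [hsum, Complex.re_sum]
        have : ∀ g ∈ (Finset.univ : Finset G), (∏ i, X i ((g : Equiv.Perm _) i)).re ≤ c + η := by
          intro g _
          have := (abs_le.1 ((Complex.abs_re_le_norm _).trans (hp g))).2
          simp only [Complex.sub_re, Complex.ofReal_re] at this
          linarith
        simpa [mul_add] using Finset.sum_le_card_nsmul _ _ _ this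
      nlinarith
  · right
    -- Subtracting `c` from each product is free because the character sums to zero.
    have hsum : normGenMatrixFun G ρ.character X =
        (1 / d) * ∑ g : G, ρ.character g * (∏ i, X i ((g : Equiv.Perm _) i) - c) := by
      rw [normGenMatrixFun, hgen, hone]
      simp only [mul_sub, Finset.sum_sub_distrib, ← Finset.sum_mul, hc, zero_mul, sub_zero]
    have hle : (normGenMatrixFun G ρ.character X).re ≤ Fintype.card G * η := by
      refine (Complex.re_le_norm _).trans ?_
      rw [hsum, norm_mul]
      have hb : ‖∑ g : G, ρ.character g * (∏ i, X i ((g : Equiv.Perm _) i) - c)‖ ≤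
          Fintype.card G * (d * η) := by
        have := norm_sum_le_of_le (Finset.univ : Finset G)
          (f := fun g => ρ.character g * (∏ i, X i ((g : Equiv.Perm _) i) - c))
          (n := fun _ => d * η) fun g _ => by
            rw [norm_mul]
            exact mul_le_mul (norm_character_le ρ g) (hp g) (norm_nonneg _) (by positivity)
        simpa using this
      have hdR : (0 : ℝ) < d := by exact_mod_cast hd
      rw [norm_div, norm_one, Complex.norm_natCast]
      calc 1 / (d : ℝ) * _ ≤ 1 / d * (Fintype.card G * (d * η)) := by gcongr
        _ = _ := by field_simp
    nlinarith

end Dominance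

/-! ### Perturbed products and the size of `bigM` -/

/-- A relative perturbation bound for products. -/
theorem norm_prod_add_sub_prod_le {ι : Type*} (t : Finset ι) (a e : ι → ℂ) {K b s : ℝ}
    (hb : 0 ≤ b) (hs : 0 ≤ s) (hs1 : s ≤ 1) (ha : ∀ i, ‖a i‖ ≤ K)
    (he : ∀ i, ‖e i‖ ≤ K * b * s) :
    ‖∏ i ∈ t, (a i + e i) - ∏ i ∈ t, a i‖ ≤ s * K ^ t.card * ((1 + b) ^ t.card - 1) := by
  classical
  induction t using Finset.induction_on with
  | empty => simp
  | insert j t hj ih =>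
    have hK : 0 ≤ K := (norm_nonneg _).trans (ha j)
    rw [Finset.prod_insert hj, Finset.prod_insert hj, Finset.card_insert_of_notMem hj]
    have hP : ‖∏ i ∈ t, a i‖ ≤ K ^ t.card := by
      rw [norm_prod]
      simpa using Finset.prod_le_prod (s := t) (fun i _ => norm_nonneg (a i)) fun i _ => ha i
    have hB : (1 : ℝ) ≤ (1 + b) ^ t.card := one_le_pow₀ (by linarith)
    have hae : ‖a j + e j‖ ≤ K * (1 + b) := by
      refine (norm_add_le _ _).trans ?_
      -- Discarding `s` only in this factor keeps the final bound linear in `s`.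
      have : K * b * s ≤ K * b := mul_le_of_le_one_right (by positivity) hs1
      linarith [ha j, he j]
    calc ‖(a j + e j) * ∏ i ∈ t, (a i + e i) - a j * ∏ i ∈ t, a i‖
        = ‖(a j + e j) * (∏ i ∈ t, (a i + e i) - ∏ i ∈ t, a i) + e j * ∏ i ∈ t, a i‖ := by
          congr 1; ring
      _ ≤ K * (1 + b) * (s * K ^ t.card * ((1 + b) ^ t.card - 1)) + K * b * s * K ^ t.card := by
          refine (norm_add_le _ _).trans ?_
          rw [norm_mul, norm_mul]
          gcongr
          exact he j
      _ = _ := by ring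

theorem eight_mul_factorial_le {n : ℕ} (hn : 4 ≤ n) : 8 * n ! ≤ n ^ n := by
  induction n, hn using Nat.le_induction with
  | base => decide
  | succ n _ ih =>
    calc 8 * (n + 1)! = (n + 1) * (8 * n !) := by rw [Nat.factorial_succ]; ring
      _ ≤ (n + 1) * (n + 1) ^ n := by
          gcongr
          exact ih.trans (Nat.pow_le_pow_left (Nat.le_succ n) n)
      _ = _ := by ring

/-- Bernoulli's inequality for `(1 + 1/(n-1))^n`. -/
theorem two_mul_sub_one_pow_le {n : ℕ} (hn : 4 ≤ n) :
    2 * ((n : ℝ) - 1) ^ n ≤ (n : ℝ) ^ n := by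
  have hn' : (4 : ℝ) ≤ n := by exact_mod_cast hn
  have h1 : (0 : ℝ) < n - 1 := by linarith
  have hb := one_add_mul_le_pow (a := 1 / ((n : ℝ) - 1)) (by
    have : 0 ≤ 1 / ((n : ℝ) - 1) := by positivity
    linarith) n
  have h2 : 2 ≤ 1 + (n : ℝ) * (1 / (n - 1)) := by
    have : 1 ≤ (n : ℝ) * (1 / (n - 1)) := by
      rw [mul_one_div, le_div_iff₀ h1]; linarith
    linarith
  have h3 : (n : ℝ) ^ n = (1 + 1 / ((n : ℝ) - 1)) ^ n * (n - 1) ^ n := by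
    rw [← mul_pow]; congr 1; field_simp; ring
  rw [h3]
  gcongr
  exact h2.trans hb

/-- The terms subtracted from `n^n` are at most `1/2`, `1/8`, `1/8` and `1/256` of it, leaving
`63/256 > 1/9`. -/
theorem pow_le_nine_mul_bigM {n : ℕ} (hn : 3 < n) : (n : ℝ) ^ n ≤ 9 * bigM n := by
  have hf : 8 * (n ! : ℝ) ≤ (n : ℝ) ^ n := by exact_mod_cast eight_mul_factorial_le hn
  have h2 := two_mul_sub_one_pow_le hn
  have h256 : (256 : ℝ) ≤ (n : ℝ) ^ n := by
    have : 4 ^ 4 ≤ n ^ n := (Nat.pow_le_pow_left hn 4).trans (Nat.pow_le_pow_right (by omega) hn)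
    exact_mod_cast this
  rcases n.even_or_odd' with ⟨k, rfl | rfl⟩
  · have hk : 2 ≤ k := by omega
    obtain ⟨j, rfl⟩ := Nat.exists_eq_add_of_le hk
    have hterm : 8 * ((2 * (2 + j) : ℕ) : ℝ) ^ ((2 * (2 + j) - 4) / 2) *
        ((((2 * (2 + j) : ℕ) : ℝ) - 2) / 2) ^ ((2 * (2 + j) + 2) / 2) *
        ((((2 * (2 + j) : ℕ) : ℝ) + 4) / 2) ≤ ((2 * (2 + j) : ℕ) : ℝ) ^ (2 * (2 + j)) := by
      have e1 : (2 * (2 + j) - 4) / 2 = j := by omega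
      have e2 : (2 * (2 + j) + 2) / 2 = j + 3 := by omega
      rw [e1, e2]
      push_cast
      set N : ℝ := 2 * (2 + j) with hN
      have hN0 : 4 ≤ N := by rw [hN]; linarith [(Nat.cast_nonneg j : (0 : ℝ) ≤ j)]
      -- The 8 cancels three of the `j + 3` halvings.
      calc 8 * N ^ j * ((N - 2) / 2) ^ (j + 3) * ((N + 4) / 2)
          ≤ 8 * N ^ j * (N / 2) ^ (j + 3) * N := by
            gcongr <;> linarith
        _ = N ^ (2 * (2 + j)) * (1 / 2) ^ j := by
            rw [div_pow, one_div, inv_pow]; field_simp; ring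
        _ ≤ N ^ (2 * (2 + j)) := mul_le_of_le_one_right (by positivity)
            (pow_le_one₀ (by norm_num) (by norm_num))
    rw [bigM, if_pos (even_two_mul _)]
    linarith
  · have hk : 2 ≤ k := by omega
    obtain ⟨j, rfl⟩ := Nat.exists_eq_add_of_le hk
    have hterm : 8 * ((2 * (2 + j) + 1 : ℕ) : ℝ) ^ ((2 * (2 + j) + 1 - 5) / 2) *
        ((((2 * (2 + j) + 1 : ℕ) : ℝ) - 1) / 2) ^ ((2 * (2 + j) + 1 + 1) / 2) *
        ((((2 * (2 + j) + 1 : ℕ) : ℝ) + 3) / 2) ≤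
          ((2 * (2 + j) + 1 : ℕ) : ℝ) ^ (2 * (2 + j) + 1) := by
      have e1 : (2 * (2 + j) + 1 - 5) / 2 = j := by omega
      have e2 : (2 * (2 + j) + 1 + 1) / 2 = j + 3 := by omega
      rw [e1, e2]
      push_cast
      set N : ℝ := 2 * (2 + j) + 1 with hN
      have hN0 : 5 ≤ N := by rw [hN]; linarith [(Nat.cast_nonneg j : (0 : ℝ) ≤ j)]
      calc 8 * N ^ j * ((N - 1) / 2) ^ (j + 3) * ((N + 3) / 2)
          ≤ 8 * N ^ j * (N / 2) ^ (j + 3) * N := by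
            gcongr <;> linarith
        _ = N ^ (2 * (2 + j)) * (1 / 2) ^ j := by
            rw [div_pow, one_div, inv_pow]; field_simp; ring
        _ ≤ N ^ (2 * (2 + j)) * 1 := by
            gcongr
            exact pow_le_one₀ (by norm_num) (by norm_num)
        _ ≤ N ^ (2 * (2 + j) + 1) := by
            rw [mul_one]
            exact pow_le_pow_right₀ (by linarith) (Nat.le_succ _)
    rw [bigM, if_neg (by simp)]
    linarith

theorem bigM_pos {n : ℕ} (hn : 3 < n) : 0 < bigM n := by
  have h := pow_le_nine_mul_bigM hn
  have : (0 : ℝ) < (n : ℝ) ^ n := by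
    have : (0 : ℝ) < n := by exact_mod_cast (by omega : 0 < n)
    positivity
  linarith

/-! ### The matrix class and its perturbation estimates -/

section MatrixClass

variable {n : ℕ} [NeZero n] {L : Matrix (Fin n) (Fin n) ℂ}

/-- The matrix `L diag(1, l²) Lᴴ`. -/
noncomputable def scaledGram (L : Matrix (Fin n) (Fin n) ℂ) (l : Fin n → ℝ) :
    Matrix (Fin n) (Fin n) ℂ :=
  L * Matrix.diagonal (fun i => if i = 0 then (1 : ℂ) else (l i : ℂ) ^ 2) * Lᴴ

theorem posSemidef_scaledGram (L : Matrix (Fin n) (Fin n) ℂ) (l : Fin n → ℝ) :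
    (scaledGram L l).PosSemidef := by
  refine Matrix.PosSemidef.mul_mul_conjTranspose_same (Matrix.PosSemidef.diagonal fun i => ?_) L
  change (0 : ℂ) ≤ if i = 0 then (1 : ℂ) else (l i : ℂ) ^ 2
  split_ifs
  · exact zero_le_one
  · exact_mod_cast sq_nonneg (l i)

theorem scaledGram_apply (L : Matrix (Fin n) (Fin n) ℂ) (l : Fin n → ℝ) (i j : Fin n) :
    scaledGram L l i j = L i 0 * star (L j 0) +
      ∑ k ∈ Finset.univ.erase 0, L i k * (l k : ℂ) ^ 2 * star (L j k) := by
  rw [scaledGram, Matrix.mul_apply, ← Finset.add_sum_erase _ _ (Finset.mem_univ 0)]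
  simp only [Matrix.mul_diagonal, Matrix.conjTranspose_apply, if_true, mul_one]
  congr 1
  exact Finset.sum_congr rfl fun k hk => by rw [if_neg (Finset.ne_of_mem_erase hk)]

theorem norm_le_restMax (L : Matrix (Fin n) (Fin n) ℂ) {i j : Fin n} (hi : i ≠ 0) (hj : j ≠ 0) :
    ‖L i j‖ ≤ restMax L :=
  le_ciSup (f := fun p : {i : Fin n // i ≠ 0} × {j : Fin n // j ≠ 0} => ‖L p.1 p.2‖)
    (Set.finite_range _).bddAbove (⟨i, hi⟩, ⟨j, hj⟩)

theorem norm_le_firstColMax (L : Matrix (Fin n) (Fin n) ℂ) (i : Fin n) :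
    ‖L i 0‖ ≤ firstColMax L :=
  le_ciSup (f := fun i => ‖L i 0‖) (Set.finite_range _).bddAbove i

theorem exists_ne_zero_of_restMax_pos (hm : 0 < restMax L) :
    ∃ i j, j ≠ 0 ∧ L i j ≠ 0 := by
  by_contra! h
  refine hm.not_ge (Real.iSup_nonpos fun p => ?_)
  simp [h p.1 p.2 p.2.2]

/-- With all `λ` equal to `t`, some diagonal entry is a constant plus a positive multiple of `t²`,
hence injective in `t > 0`. -/
theorem infinite_matrixClass (hm : 0 < restMax L) {a : ℝ} (ha : 0 < a) :
    (matrixClass L a).Infinite := by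
  obtain ⟨i, j, hj, hij⟩ := exists_ne_zero_of_restMax_pos hm
  refine Set.infinite_of_injOn_mapsTo (f := fun t : ℝ => scaledGram L fun _ => t)
    (s := Set.Ioc 0 a) ?_ (fun t ht => ⟨fun _ => t, fun _ _ => ht, rfl⟩) (Set.Ioc_infinite ha)
  intro t ht u hu htu
  have h := congrFun (congrFun htu i) i
  have hS : 0 < ∑ k ∈ Finset.univ.erase 0, ‖L i k‖ ^ 2 :=
    Finset.sum_pos' (fun _ _ => by positivity)
      ⟨j, Finset.mem_erase.2 ⟨hj, Finset.mem_univ j⟩, by positivity⟩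
  have hsum : ∀ r : ℝ, ∑ k ∈ Finset.univ.erase 0, L i k * (r : ℂ) ^ 2 * star (L i k) =
      ((r ^ 2 * ∑ k ∈ Finset.univ.erase 0, ‖L i k‖ ^ 2 : ℝ) : ℂ) := by
    intro r
    push_cast
    rw [Finset.mul_sum]
    refine Finset.sum_congr rfl fun k _ => ?_
    rw [← Complex.mul_conj', mul_right_comm, mul_comm]
    rfl
  simp only [scaledGram_apply, hsum] at h
  have h' := mul_right_cancel₀ hS.ne' (Complex.ofReal_injective (add_left_cancel h))
  exact (pow_left_inj₀ ht.1.le hu.1.le two_ne_zero).1 h'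

theorem firstColMax_pos (hcol : ∀ i, L i 0 ≠ 0) : 0 < firstColMax L :=
  (norm_pos_iff.2 (hcol 0)).trans_le (norm_le_firstColMax L 0)

theorem firstColProd_pos (hcol : ∀ i, L i 0 ≠ 0) : 0 < firstColProd L :=
  Finset.prod_pos fun i _ => norm_pos_iff.2 (hcol i)

theorem firstColProd_le (L : Matrix (Fin n) (Fin n) ℂ) : firstColProd L ≤ firstColMax L ^ n := by
  simpa [firstColProd] using Finset.prod_le_prod (s := Finset.univ) (fun i _ => norm_nonneg (L i 0))
    fun i _ => norm_le_firstColMax L i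

theorem eps_pos (hn : 3 < n) (hcol : ∀ i, L i 0 ≠ 0) : 0 < eps L := by
  have h1 := bigM_pos hn
  have h2 := firstColMax_pos hcol
  have h3 := firstColProd_pos hcol
  have h4 : (0 : ℝ) < n ! := by exact_mod_cast n.factorial_pos
  exact lt_min (by positivity) one_pos

/-- This is `4η ≤ c`. It follows from `n! ≥ 24` and `n^n ≤ 9 M_n`, as `3 · 24 = 8 · 9`. -/
theorem eps_sq_mul_le (hn : 3 < n) (hcol : ∀ i, L i 0 ≠ 0) :
    4 * (eps L ^ 2 * (firstColMax L ^ (n - 1)) ^ 2 * (n : ℝ) ^ n) ≤ firstColProd L ^ 2 := by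
  have hM := bigM_pos hn
  have hq := pow_pos (firstColMax_pos hcol) (n - 1)
  have hα := firstColProd_pos hcol
  have hf : (24 : ℝ) ≤ n ! := by exact_mod_cast (Nat.factorial_le hn : 4 ! ≤ n !)
  have hle := pow_le_nine_mul_bigM hn
  set q := firstColMax L ^ (n - 1)
  have h1 : eps L * q ≤ firstColProd L * √(2 / (3 * (n ! : ℝ) * bigM n)) := by
    have := mul_le_mul_of_nonneg_right (min_le_left (firstColProd L / q *
      √(2 / (3 * (n ! : ℝ) * bigM n))) 1) hq.le
    refine this.trans_eq ?_
    field_simp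
  have h2 : eps L ^ 2 * q ^ 2 ≤ firstColProd L ^ 2 * (2 / (3 * (n ! : ℝ) * bigM n)) := by
    rw [← mul_pow, ← Real.sq_sqrt (show 0 ≤ 2 / (3 * (n ! : ℝ) * bigM n) by positivity),
      ← mul_pow]
    exact pow_le_pow_left₀ (mul_nonneg (eps_pos hn hcol).le hq.le) h1 2
  have h3 : 2 / (3 * (n ! : ℝ) * bigM n) ≤ 1 / (4 * (n : ℝ) ^ n) := by
    have hn0 : (0 : ℝ) < n := by exact_mod_cast (by omega : 0 < n)
    rw [div_le_div_iff₀ (by positivity) (by positivity)]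
    nlinarith
  have hn0 : (0 : ℝ) < n := by exact_mod_cast (by omega : 0 < n)
  calc 4 * (eps L ^ 2 * q ^ 2 * (n : ℝ) ^ n)
      ≤ 4 * (firstColProd L ^ 2 * (1 / (4 * (n : ℝ) ^ n)) * (n : ℝ) ^ n) := by
        have h4 := h2.trans (mul_le_mul_of_nonneg_left h3 (sq_nonneg (firstColProd L)))
        exact mul_le_mul_of_nonneg_left (mul_le_mul_of_nonneg_right h4 (by positivity))
          (by norm_num)
    _ = firstColProd L ^ 2 := by field_simp

theorem satisfiesPermanentDominance_scaledGram (hn : 3 < n) (hL : L.IsLowerTriangular)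
    (hcol : ∀ i, L i 0 ≠ 0) (hm : 0 < restMax L) {l : Fin n → ℝ}
    (hl : ∀ i, i ≠ 0 → 0 < l i ∧ l i ≤ eps L / restMax L) :
    SatisfiesPermanentDominance (scaledGram L l) := by
  have hα0 := firstColMax_pos hcol
  have hε := eps_pos hn hcol
  have hkey := eps_sq_mul_le hn hcol
  have hnR : (1 : ℝ) ≤ n := by exact_mod_cast (by omega : 1 ≤ n)
  have hpow : firstColMax L ^ n = firstColMax L ^ (n - 1) * firstColMax L := by
    rw [← pow_succ]; congr 1; omega
  have hq := pow_pos hα0 (n - 1)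
  have hent : ∀ i k : Fin n, k ≠ 0 → ‖L i k‖ * l k ≤ eps L := by
    intro i k hk
    -- `restMax` does not see row `0`; triangularity covers it.
    by_cases hi : i = 0
    · subst hi
      have : L 0 k = 0 := hL (OrderDual.toDual_lt_toDual.2 (Fin.pos_iff_ne_zero.2 hk))
      simpa [this] using hε.le
    · calc ‖L i k‖ * l k ≤ restMax L * (eps L / restMax L) := by
            gcongr
            · exact (hl k hk).1.le
            · exact norm_le_restMax L hi hk
            · exact (hl k hk).2
        _ = eps L := by field_simp
  -- Written as `K * b * s` with `b = n - 1`, so that `(1 + b)^n` becomes `n^n`.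
  have hE : ∀ i j, ‖∑ k ∈ Finset.univ.erase 0, L i k * (l k : ℂ) ^ 2 * star (L j k)‖ ≤
      firstColMax L ^ 2 * (n - 1) * (eps L ^ 2 / firstColMax L ^ 2) := by
    intro i j
    have : ∀ k ∈ Finset.univ.erase (0 : Fin n),
        ‖L i k * (l k : ℂ) ^ 2 * star (L j k)‖ ≤ eps L ^ 2 := by
      intro k hk
      have hk0 := Finset.ne_of_mem_erase hk
      have hlk := (hl k hk0).1
      have hnorm : ‖L i k * (l k : ℂ) ^ 2 * star (L j k)‖ =
          (‖L i k‖ * l k) * (‖L j k‖ * l k) := by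
        rw [norm_mul, norm_mul, norm_pow, norm_star, Complex.norm_real, Real.norm_of_nonneg hlk.le]
        ring
      rw [hnorm, sq]
      exact mul_le_mul (hent i k hk0) (hent j k hk0) (by positivity) hε.le
    refine (norm_sum_le_of_le _ this).trans_eq ?_
    rw [Finset.sum_const, Finset.card_erase_of_mem (Finset.mem_univ _), Finset.card_univ,
      Fintype.card_fin, nsmul_eq_mul, Nat.cast_sub (by omega)]
    field_simp
    simp
  have hs1 : eps L ^ 2 / firstColMax L ^ 2 ≤ 1 := by
    rw [div_le_one (by positivity)]
    have h1 : firstColProd L ^ 2 ≤ firstColMax L ^ 2 * (firstColMax L ^ (n - 1)) ^ 2 := by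
      have := pow_le_pow_left₀ (firstColProd_pos hcol).le (firstColProd_le L) 2
      rwa [hpow, mul_pow, mul_comm] at this
    have h2 : (1 : ℝ) ≤ (n : ℝ) ^ n := one_le_pow₀ hnR
    have h3 : eps L ^ 2 * (firstColMax L ^ (n - 1)) ^ 2 ≤
        eps L ^ 2 * (firstColMax L ^ (n - 1)) ^ 2 * (n : ℝ) ^ n :=
      le_mul_of_one_le_right (by positivity) h2
    have h4 : 0 ≤ eps L ^ 2 * (firstColMax L ^ (n - 1)) ^ 2 * (n : ℝ) ^ n := by positivity
    refine le_of_mul_le_mul_right ?_ (pow_pos hq 2)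
    linarith
  refine satisfiesPermanentDominance_of_near (posSemidef_scaledGram L l).isHermitian hkey
    (fun σ => ?_)
  have hprod : ∏ i, L i 0 * star (L (σ i) 0) = ((firstColProd L ^ 2 : ℝ) : ℂ) := by
    rw [Finset.prod_mul_distrib, Equiv.prod_comp σ fun i => star (L i 0), ← star_prod, firstColProd,
      ← norm_prod, Complex.ofReal_pow, ← Complex.mul_conj']
    rfl
  have hpert := norm_prod_add_sub_prod_le Finset.univ (fun i => L i 0 * star (L (σ i) 0))
    (fun i => ∑ k ∈ Finset.univ.erase 0, L i k * (l k : ℂ) ^ 2 * star (L (σ i) k))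
    (K := firstColMax L ^ 2) (b := n - 1) (s := eps L ^ 2 / firstColMax L ^ 2)
    (by linarith) (by positivity) hs1 (fun i => by
      rw [norm_mul, norm_star, sq]
      exact mul_le_mul (norm_le_firstColMax L i) (norm_le_firstColMax L _) (norm_nonneg _) hα0.le)
    (fun i => hE i (σ i))
  simp only [← scaledGram_apply, hprod, Finset.card_univ, Fintype.card_fin,
    add_sub_cancel] at hpert
  refine hpert.trans ?_
  calc eps L ^ 2 / firstColMax L ^ 2 * (firstColMax L ^ 2) ^ n * ((n : ℝ) ^ n - 1)
      ≤ eps L ^ 2 / firstColMax L ^ 2 * (firstColMax L ^ 2) ^ n * (n : ℝ) ^ n := by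
        gcongr
        linarith
    _ = eps L ^ 2 * (firstColMax L ^ (n - 1)) ^ 2 * (n : ℝ) ^ n := by
        rw [pow_right_comm, hpow]
        field_simp

end MatrixClass

end PermDom

theorem mainTheorem5 (n : ℕ) [NeZero n] (hn : 3 < n) (A L : Matrix (Fin n) (Fin n) ℂ)
    (hL : L.IsLowerTriangular) (hA : A = L * Lᴴ) (hcol : ∀ i, A i 0 ≠ 0)
    (hm : 0 < PermDom.restMax L) :
    (PermDom.matrixClass L (PermDom.eps L / PermDom.restMax L)).Infinite ∧
      ∀ X ∈ PermDom.matrixClass L (PermDom.eps L / PermDom.restMax L),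
        X.PosSemidef ∧ PermDom.SatisfiesPermanentDominance X := by
  -- Row `0` of `L` vanishes off the diagonal, so `A i 0 = L i 0 * star (L 0 0)`.
  have hcolL : ∀ i, L i 0 ≠ 0 := by
    intro i hi
    refine hcol i ?_
    rw [hA, Matrix.mul_apply]
    refine Finset.sum_eq_zero fun k _ => ?_
    by_cases hk : k = 0
    · rw [hk, hi, zero_mul]
    · have : L 0 k = 0 := hL (OrderDual.toDual_lt_toDual.2 (Fin.pos_iff_ne_zero.2 hk))
      rw [Matrix.conjTranspose_apply, this, star_zero, mul_zero]
  refine ⟨PermDom.infinite_matrixClass hm (div_pos (PermDom.eps_pos hn hcolL) hm), ?_⟩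
  rintro X ⟨l, hl, rfl⟩
  exact ⟨PermDom.posSemidef_scaledGram L l,
    PermDom.satisfiesPermanentDominance_scaledGram hn hL hcolL hm hl⟩
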